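/- Let $n\ge 1$, $A\in\mathbb{R}^{n\times n}$, $B\in\mathbb{R}^{n\times 1}$, $T>0$ and $N\ge 1$. Let $0\le U_{\min}=U_1<U_2<\dots<U_N=1$, and let $w_1,\dots,w_N\ge 0$ be weights with $w_1>0$ and $w_1+\dots+w_N=1$. For $\xi\in\mathbb{R}^n$ let $\mathcal{U}(\xi)$ be the set of measurable controls $u:[0,T]\to\mathbb{R}$ with $\|u\|_\infty\le 1$ for which the solution of $\dot x(t)=Ax(t)+Bu(t)$, $x(0)=\xi$, satisfies $x(T)=0$. Put $$J(u)=\sum_{i=1}^N w_i\bigl(\|u-U_i\|_1+\|u+U_i\|_1\bigr),\qquad \|v\|_1=\int_0^T|v(t)|\,dt,$$ and call $u\in\mathcal{U}(\xi)$ an SOAV (sum-of-absolute-values) optimal control for $\xi$ if it minimizes $J$ over $\mathcal{U}(\xi)$. Let $$\mathcal{R}=\Bigl\{\int_0^T e^{-At}Bu(t)\,dt:\ u \text{ measurable},\ \|u\|_\infty\le 1\Bigr\},$$ and let $\mathcal{R}_{\min}$ be the set of all $\xi$ for which the optimal value $\min_{u\in\mathcal{U}(\xi)}J(u)$ exists and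 equals $J_{\min}=2T\sum_{i=1}^N w_iU_i$. Assume that $A$ is nonsingular and that $(A,B)$ is controllable, i.e. $[B\ AB\ \cdots\ A^{n-1}B]$ has rank $n$. Then for every $\xi\in\mathcal{R}\setminus\mathcal{R}_{\min}$ there is an SOAV optimal control, and it is unique up to equality almost everywhere on $[0,T]$. In particular, if $U_{\min}=0$, the same holds for every $\xi\in\mathcal{R}$. -/

import Mathlib

open MeasureTheory Set
open scoped Matrix

noncomputable section

namespace SOAV

/-- A measurable control `u` on `[0, T]` whose essential supremum norm satisfies `‖u‖_∞ ≤ r`. -/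
def BoundedControl (T r : ℝ) (u : ℝ → ℝ) : Prop :=
  AEStronglyMeasurable u (volume.restrict (Icc 0 T)) ∧
    eLpNorm u ⊤ (volume.restrict (Icc 0 T)) ≤ ENNReal.ofReal r

/-- `x` is a (Carathéodory) solution on `[0, T]` of `x' = A x + B u`: it is continuous and
satisfies the integrated equation. -/
def IsTrajectory {n : ℕ} (A : Matrix (Fin n) (Fin n) ℝ) (B : Fin n → ℝ) (T : ℝ)
    (u : ℝ → ℝ) (x : ℝ → Fin n → ℝ) : Prop :=
  IntervalIntegrable u volume 0 T ∧
    ContinuousOn x (Icc 0 T) ∧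
    ∀ t ∈ Icc (0 : ℝ) T, x t = x 0 + ∫ s in (0 : ℝ)..t, (A *ᵥ x s + u s • B)

/-- The feasible controls for the initial state `ξ`: `‖u‖_∞ ≤ 1`, and `u` steers the state
from `x 0 = ξ` to `x T = 0`. -/
def feasible {n : ℕ} (A : Matrix (Fin n) (Fin n) ℝ) (B : Fin n → ℝ) (T : ℝ)
    (ξ : Fin n → ℝ) : Set (ℝ → ℝ) :=
  {u | BoundedControl T 1 u ∧ ∃ x, IsTrajectory A B T u x ∧ x 0 = ξ ∧ x T = 0}

/-- The `L¹` norm of a signal on `[0, T]`. -/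
def l1Norm (T : ℝ) (v : ℝ → ℝ) : ℝ := ∫ t in (0 : ℝ)..T, |v t|

/-- The SOAV cost `J(u) = ∑ i, w i (‖u - U i‖₁ + ‖u + U i‖₁)`. -/
def cost {N : ℕ} (T : ℝ) (U w : Fin (N + 1) → ℝ) (u : ℝ → ℝ) : ℝ :=
  ∑ i, w i * (l1Norm T (fun t => u t - U i) + l1Norm T (fun t => u t + U i))

/-- `u` is an SOAV optimal control for the initial state `ξ`. -/
def IsOptimal {n N : ℕ} (A : Matrix (Fin n) (Fin n) ℝ) (B : Fin n → ℝ) (T : ℝ)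
    (U w : Fin (N + 1) → ℝ) (ξ : Fin n → ℝ) (u : ℝ → ℝ) : Prop :=
  u ∈ feasible A B T ξ ∧ ∀ v ∈ feasible A B T ξ, cost T U w u ≤ cost T U w v

/-- The reachable set `R = {∫₀ᵀ e^{-At} B u(t) dt : ‖u‖_∞ ≤ 1}`. -/
def reachable {n : ℕ} (A : Matrix (Fin n) (Fin n) ℝ) (B : Fin n → ℝ) (T : ℝ) :
    Set (Fin n → ℝ) :=
  {ξ | ∃ u, BoundedControl T 1 u ∧
    ξ = ∫ t in (0 : ℝ)..T, u t • (NormedSpace.exp (-(t • A)) *ᵥ B)}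

/-- `J_min = 2 T ∑ i, w i * U i`. -/
def costMin {N : ℕ} (T : ℝ) (U w : Fin (N + 1) → ℝ) : ℝ := 2 * T * ∑ i, w i * U i

/-- `R_min`: the initial states for which the optimal value of the problem (the minimum of the
cost over the feasible controls) equals `J_min`. -/
def reachableMin {n N : ℕ} (A : Matrix (Fin n) (Fin n) ℝ) (B : Fin n → ℝ) (T : ℝ)
    (U w : Fin (N + 1) → ℝ) : Set (Fin n → ℝ) :=
  {ξ | IsLeast (cost T U w '' feasible A B T ξ) (costMin T U w)}

/-- `[B  AB  ⋯  A^{n-1}B]`. -/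
def controllabilityMatrix {n : ℕ} (A : Matrix (Fin n) (Fin n) ℝ) (B : Fin n → ℝ) :
    Matrix (Fin n) (Fin n) ℝ :=
  Matrix.of fun i k => ((A ^ (k : ℕ)) *ᵥ B) i

/-- The pair `(A, B)` is controllable. -/
def Controllable {n : ℕ} (A : Matrix (Fin n) (Fin n) ℝ) (B : Fin n → ℝ) : Prop :=
  (controllabilityMatrix A B).rank = n

/-- There is an SOAV optimal control for `ξ`, and any other one agrees with it almost everywhere
on `[0, T]`. -/
def HasUniqueOptimal {n N : ℕ} (A : Matrix (Fin n) (Fin n) ℝ) (B : Fin n → ℝ) (T : ℝ)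
    (U w : Fin (N + 1) → ℝ) (ξ : Fin n → ℝ) : Prop :=
  ∃ u, IsOptimal A B T U w ξ u ∧
    ∀ v, IsOptimal A B T U w ξ v → v =ᵐ[volume.restrict (Icc 0 T)] u

end SOAV

end

open Filter Topology

namespace SOAV

/-! By variation of constants (`mem_feasible_iff`), `u` is feasible iff `|u| ≤ 1` a.e. and `∫ u(t)
e^{-At}B dt = -ξ`, and the cost is `∫ F(u(t)) dt` for one convex `F`. Existence comes from nested
convex sets of near-optimal controls in L² (`exists_unitBounded_minimizer`).

Uniqueness cannot come from strict convexity, since `F` is piecewise affine. A hyperplane supporting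
the set of (value, moment) pairs gives multipliers `(c, p) ≠ 0` (`exists_multiplier`), and every
optimal control minimizes `∫ (c F(u) + u q)` with `q(t) = p(e^{-At}B)`. If `p = 0`, comparison with
the zero control gives optimal value `J_min`, so `ξ ∈ R_min`. If `p ≠ 0`, then `q` is analytic and
nonconstant, so its level sets are null (`Controllable.ae_ne`); two distinct minimizers of `c F(s) +
s q(t)` would force `-q(t)` into a countable set of chord slopes
(`UnitBounded.ae_eq_of_minimizers`).

If `U_min = 0`, the density `F` is minimal only at `0`, so on `R_min` the optimal control is zero
a.e. -/

/-- A decreasing sequence of nonempty closed bounded convex sets in a Hilbert space has a common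
point. -/
theorem exists_mem_iInter_of_antitone_convex {E : Type*} [NormedAddCommGroup E]
    [InnerProductSpace ℝ E] [CompleteSpace E] {K : ℕ → Set E} (hanti : Antitone K)
    (hne : ∀ k, (K k).Nonempty) (hcl : ∀ k, IsClosed (K k)) (hconv : ∀ k, Convex ℝ (K k))
    {C : ℝ} (hbd : ∀ x ∈ K 0, ‖x‖ ≤ C) : ∃ x, ∀ k, x ∈ K k := by
  have hmin : ∀ k, ∃ m ∈ K k, ∀ y ∈ K k, ‖m‖ ≤ ‖y‖ := by
    intro k
    obtain ⟨m, hm, hm'⟩ :=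
      exists_norm_eq_iInf_of_complete_convex (hne k) (hcl k).isComplete (hconv k) 0
    refine ⟨m, hm, fun y hy => ?_⟩
    have : ⨅ w : K k, ‖(0 : E) - w‖ ≤ ‖(0 : E) - (⟨y, hy⟩ : K k)‖ :=
      ciInf_le ⟨0, by rintro _ ⟨w, rfl⟩; exact norm_nonneg _⟩ _
    rw [← hm'] at this
    simpa using this
  choose m hmK hm using hmin
  have hmono : Monotone fun k => ‖m k‖ ^ 2 := fun i j hij =>
    pow_le_pow_left₀ (norm_nonneg _) (hm i _ (hanti hij (hmK j))) 2
  have hbdd : BddAbove (range fun k => ‖m k‖ ^ 2) := by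
    refine ⟨C ^ 2, ?_⟩
    rintro _ ⟨k, rfl⟩
    exact pow_le_pow_left₀ (norm_nonneg _) (hbd _ (hanti (Nat.zero_le k) (hmK k))) 2
  have hcs : CauchySeq fun k => ‖m k‖ ^ 2 := (tendsto_atTop_ciSup hmono hbdd).cauchySeq
  -- The midpoint of `m i` and `m j` lies in `K i`, so its norm is at least `‖m i‖`; the
  -- parallelogram law does the rest.
  have hdist : ∀ i j, i ≤ j → ‖m j - m i‖ ^ 2 ≤ 2 * (‖m j‖ ^ 2 - ‖m i‖ ^ 2) := by
    intro i j hij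
    have hmid : (1 / 2 : ℝ) • m j + (1 / 2 : ℝ) • m i ∈ K i :=
      hconv i (hanti hij (hmK j)) (hmK i) (by norm_num) (by norm_num) (by norm_num)
    have h1 := hm i _ hmid
    rw [← smul_add, norm_smul] at h1
    norm_num at h1
    have h2 := parallelogram_law_with_norm ℝ (m j) (m i)
    nlinarith [norm_nonneg (m i), norm_nonneg (m j + m i)]
  have hcauchy : CauchySeq m := by
    rw [Metric.cauchySeq_iff'] at hcs ⊢
    intro ε hε
    obtain ⟨N, hN⟩ := hcs (ε ^ 2 / 2) (by positivity)
    refine ⟨N, fun k hk => ?_⟩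
    have h1 := hdist N k hk
    have h2 := hN k hk
    rw [Real.dist_eq] at h2
    have h3 := le_abs_self (‖m k‖ ^ 2 - ‖m N‖ ^ 2)
    rw [dist_eq_norm]
    exact lt_of_pow_lt_pow_left₀ 2 hε.le (by linarith)
  obtain ⟨x, hx⟩ := cauchySeq_tendsto_of_complete hcauchy
  refine ⟨x, fun k => (hcl k).mem_of_tendsto hx ?_⟩
  filter_upwards [eventually_ge_atTop k] with j hj using hanti hj (hmK j)

/-- A convex set in a finite-dimensional space has a supporting hyperplane at each of its points
that is not interior. -/
theorem exists_supporting_functional {V : Type*} [NormedAddCommGroup V] [NormedSpace ℝ V]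
    [FiniteDimensional ℝ V] {s : Set V} (hs : Convex ℝ s) {x : V} (hx : x ∈ s)
    (hxi : x ∉ interior s) : ∃ f : V →ₗ[ℝ] ℝ, f ≠ 0 ∧ ∀ y ∈ s, f x ≤ f y := by
  by_cases hint : (interior s).Nonempty
  · obtain ⟨f, hf, hfs⟩ := geometric_hahn_banach_of_nonempty_interior_point hs hxi hint
    refine ⟨-(f : V →ₗ[ℝ] ℝ), ?_, fun y hy => by simpa using hfs y hy⟩
    rw [neg_ne_zero]
    intro h
    exact hf (ContinuousLinearMap.coe_injective h)
  -- With empty interior, `s` lies in a proper affine subspace, and some nonzero functional is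
  -- constant on `s`.
  · rw [hs.interior_nonempty_iff_affineSpan_eq_top] at hint
    have hdir : vectorSpan ℝ s ≠ ⊤ := fun h =>
      hint ((AffineSubspace.affineSpan_eq_top_iff_vectorSpan_eq_top_of_nonempty ℝ V V ⟨x, hx⟩).2 h)
    obtain ⟨f, hf, hfs⟩ := Submodule.exists_le_ker_of_lt_top _ (lt_top_iff_ne_top.2 hdir)
    refine ⟨f, hf, fun y hy => ?_⟩
    have := hfs (vsub_mem_vectorSpan ℝ hy hx)
    rw [LinearMap.mem_ker, vsub_eq_sub, map_sub, sub_eq_zero] at this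
    exact this.ge

/-! ### Convex integral functionals on unit-bounded functions -/

section UnitBounded

variable {α : Type*} [MeasurableSpace α]

/-- Measurable functions bounded by one almost everywhere. -/
def UnitBounded (μ : Measure α) (u : α → ℝ) : Prop :=
  AEStronglyMeasurable u μ ∧ ∀ᵐ t ∂μ, |u t| ≤ 1

namespace UnitBounded

variable {μ : Measure α} {u v : α → ℝ}

theorem congr (hu : UnitBounded μ u) (h : u =ᵐ[μ] v) : UnitBounded μ v := by
  refine ⟨hu.1.congr h, ?_⟩
  filter_upwards [hu.2, h] with t h1 h2
  rwa [← h2]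

theorem integrable_smul {E : Type*} [NormedAddCommGroup E] [NormedSpace ℝ E]
    (hu : UnitBounded μ u) {Φ : α → E} (hΦ : Integrable Φ μ) :
    Integrable (fun t => u t • Φ t) μ := by
  refine hΦ.mono (hu.1.smul hΦ.1) ?_
  filter_upwards [hu.2] with t ht
  rw [norm_smul, Real.norm_eq_abs]
  exact mul_le_of_le_one_left (norm_nonneg _) ht

theorem exists_bound {F : ℝ → ℝ} (hF : Continuous F) :
    ∃ C, ∀ s : ℝ, |s| ≤ 1 → ‖F s‖ ≤ C := by
  obtain ⟨C, hC⟩ := (isCompact_Icc (a := (-1 : ℝ)) (b := 1)).exists_bound_of_continuousOn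
    hF.continuousOn
  exact ⟨C, fun s hs => hC s (abs_le.1 hs)⟩

theorem integrable_comp [IsFiniteMeasure μ] (hu : UnitBounded μ u) {F : ℝ → ℝ}
    (hF : Continuous F) : Integrable (fun t => F (u t)) μ := by
  obtain ⟨C, hC⟩ := exists_bound hF
  refine Integrable.of_bound (hF.comp_aestronglyMeasurable hu.1) C ?_
  filter_upwards [hu.2] with t ht using hC _ ht

theorem integrable [IsFiniteMeasure μ] (hu : UnitBounded μ u) : Integrable u μ :=
  hu.integrable_comp continuous_id

theorem memLp [IsFiniteMeasure μ] (hu : UnitBounded μ u) : MemLp u 2 μ :=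
  MemLp.of_bound hu.1 1 hu.2

theorem piecewise (hu : UnitBounded μ u) (hv : UnitBounded μ v) {s : Set α}
    [DecidablePred (· ∈ s)] (hs : MeasurableSet s) : UnitBounded μ (s.piecewise u v) := by
  refine ⟨hu.1.restrict.piecewise hs hv.1.restrict, ?_⟩
  filter_upwards [hu.2, hv.2] with t h1 h2
  by_cases h : t ∈ s <;> simp [h, h1, h2]

theorem convex_comb (hu : UnitBounded μ u) (hv : UnitBounded μ v) {a b : ℝ} (ha : 0 ≤ a)
    (hb : 0 ≤ b) (hab : a + b = 1) : UnitBounded μ (a • u + b • v) := by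
  refine ⟨(hu.1.const_smul a).add (hv.1.const_smul b), ?_⟩
  filter_upwards [hu.2, hv.2] with t h1 h2
  have := convex_Icc (-1 : ℝ) 1 (abs_le.1 h1) (abs_le.1 h2) ha hb hab
  exact abs_le.2 this

theorem const {c : ℝ} (hc : |c| ≤ 1) : UnitBounded μ fun _ => c :=
  ⟨aestronglyMeasurable_const, ae_of_all _ fun _ => hc⟩

theorem integral_convex_comb_le [IsFiniteMeasure μ] {F : ℝ → ℝ} (hF : Continuous F)
    (hFc : ConvexOn ℝ univ F) (hu : UnitBounded μ u) (hv : UnitBounded μ v) {a b : ℝ}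
    (ha : 0 ≤ a) (hb : 0 ≤ b) (hab : a + b = 1) :
    ∫ t, F ((a • u + b • v) t) ∂μ ≤ a * ∫ t, F (u t) ∂μ + b * ∫ t, F (v t) ∂μ := by
  have h1 := hu.integrable_comp hF
  have h2 := hv.integrable_comp hF
  rw [← integral_const_mul, ← integral_const_mul,
    ← integral_add (h1.const_mul a) (h2.const_mul b)]
  exact integral_mono ((hu.convex_comb hv ha hb hab).integrable_comp hF)
    ((h1.const_mul a).add (h2.const_mul b))
    fun t => hFc.2 (mem_univ _) (mem_univ _) ha hb hab

theorem integral_convex_comb_smul {E : Type*} [NormedAddCommGroup E] [NormedSpace ℝ E]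
    {Φ : α → E} (hΦ : Integrable Φ μ) (hu : UnitBounded μ u) (hv : UnitBounded μ v) (a b : ℝ) :
    ∫ t, (a • u + b • v) t • Φ t ∂μ = a • ∫ t, u t • Φ t ∂μ + b • ∫ t, v t • Φ t ∂μ := by
  rw [← integral_smul, ← integral_smul]
  refine Eq.trans ?_ (integral_add ((hu.integrable_smul hΦ).smul a)
    ((hv.integrable_smul hΦ).smul b))
  congr 1 with t
  simp [add_smul, mul_smul]

end UnitBounded

/-- A continuous convex integral functional attains its minimum on the unit-bounded functions
subject to a linear integral constraint. -/
theorem exists_unitBounded_minimizer {E : Type*} [NormedAddCommGroup E] [NormedSpace ℝ E]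
    {μ : Measure α} [IsFiniteMeasure μ] {Φ : α → E} (hΦ : Integrable Φ μ) {F : ℝ → ℝ}
    (hF : Continuous F) (hFc : ConvexOn ℝ univ F) {η : E} {u₀ : α → ℝ} (hu₀ : UnitBounded μ u₀)
    (hη : ∫ t, u₀ t • Φ t ∂μ = η) :
    ∃ u, UnitBounded μ u ∧ ∫ t, u t • Φ t ∂μ = η ∧
      ∀ v, UnitBounded μ v → ∫ t, v t • Φ t ∂μ = η → ∫ t, F (u t) ∂μ ≤ ∫ t, F (v t) ∂μ := by
  obtain ⟨C, hC⟩ := UnitBounded.exists_bound hF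
  set S : Set ℝ := {r | ∃ v, UnitBounded μ v ∧ ∫ t, v t • Φ t ∂μ = η ∧ ∫ t, F (v t) ∂μ = r}
  have hSne : S.Nonempty := ⟨_, u₀, hu₀, hη, rfl⟩
  have hSbdd : BddBelow S := by
    refine ⟨-(C * μ.real univ), ?_⟩
    rintro _ ⟨v, hv, -, rfl⟩
    have := norm_integral_le_of_norm_le_const (μ := μ) (f := fun t => F (v t)) (C := C)
      (by filter_upwards [hv.2] with t ht using hC _ ht)
    exact (abs_le.1 this).1
  -- Admissible classes within `1 / (k + 1)` of the infimum; a point common to all of them is a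
  -- minimizer.
  set K : ℕ → Set (Lp ℝ 2 μ) := fun k => {f | UnitBounded μ f ∧ ∫ t, f t • Φ t ∂μ = η ∧
    ∫ t, F (f t) ∂μ ≤ sInf S + 1 / ((k : ℝ) + 1)} with hK
  have hanti : Antitone K := by
    rintro i j hij f ⟨h1, h2, h3⟩
    exact ⟨h1, h2, h3.trans (add_le_add le_rfl (Nat.one_div_le_one_div hij))⟩
  have hne : ∀ k, (K k).Nonempty := by
    intro k
    obtain ⟨_, ⟨v, hv, hvη, rfl⟩, hlt⟩ :=
      Real.lt_sInf_add_pos hSne (ε := 1 / ((k : ℝ) + 1)) (by positivity)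
    have hae : v =ᵐ[μ] hv.memLp.toLp v := hv.memLp.coeFn_toLp.symm
    refine ⟨hv.memLp.toLp v, hv.congr hae, ?_, ?_⟩
    · rw [← hvη]
      exact integral_congr_ae (hae.mono fun t ht => by simp only [ht])
    · refine le_trans (le_of_eq ?_) hlt.le
      exact integral_congr_ae (hae.mono fun t ht => by simp only [ht])
  have hconv : ∀ k, Convex ℝ (K k) := by
    rintro k f ⟨hf1, hf2, hf3⟩ g ⟨hg1, hg2, hg3⟩ a b ha hb hab
    have hae : (a • ⇑f + b • ⇑g : α → ℝ) =ᵐ[μ] (a • f + b • g : Lp ℝ 2 μ) := by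
      filter_upwards [Lp.coeFn_add (a • f) (b • g), Lp.coeFn_smul a f, Lp.coeFn_smul b g]
        with t h1 h2 h3
      rw [h1, Pi.add_apply, Pi.add_apply, h2, h3]
    refine ⟨(hf1.convex_comb hg1 ha hb hab).congr hae, ?_, ?_⟩
    · refine (integral_congr_ae (hae.mono fun t ht => congrArg (· • Φ t) ht)).symm.trans ?_
      rw [UnitBounded.integral_convex_comb_smul hΦ hf1 hg1, hf2, hg2, ← add_smul, hab, one_smul]
    · refine (integral_congr_ae (hae.mono fun t ht => congrArg F ht)).symm.trans_le ?_
      exact (UnitBounded.integral_convex_comb_le hF hFc hf1 hg1 ha hb hab).trans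
        (mem_Iic.1 (convex_Iic (sInf S + 1 / ((k : ℝ) + 1)) (mem_Iic.2 hf3) (mem_Iic.2 hg3)
          ha hb hab))
  have hcl : ∀ k, IsClosed (K k) := by
    intro k
    refine IsSeqClosed.isClosed fun f g hf hfg => ?_
    -- An a.e. convergent subsequence lets dominated convergence pass every constraint to the limit.
    obtain ⟨φ, -, hφ⟩ := (tendstoInMeasure_of_tendsto_Lp hfg).exists_seq_tendsto_ae
    have hall : ∀ᵐ t ∂μ, ∀ i, |f (φ i) t| ≤ 1 := ae_all_iff.2 fun i => (hf (φ i)).1.2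
    have hg1 : UnitBounded μ g := by
      refine ⟨(Lp.memLp g).1, ?_⟩
      filter_upwards [hall, hφ] with t h1 h2
      exact le_of_tendsto' h2.abs h1
    refine ⟨hg1, ?_, ?_⟩
    · have : Tendsto (fun i => ∫ t, f (φ i) t • Φ t ∂μ) atTop (𝓝 (∫ t, g t • Φ t ∂μ)) := by
        refine tendsto_integral_of_dominated_convergence (fun t => ‖Φ t‖)
          (fun i => ((hf (φ i)).1.integrable_smul hΦ).1) hΦ.norm (fun i => ?_) ?_
        · filter_upwards [hall] with t ht
          rw [norm_smul, Real.norm_eq_abs]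
          exact mul_le_of_le_one_left (norm_nonneg _) (ht i)
        · filter_upwards [hφ] with t ht using ht.smul_const _
      exact tendsto_nhds_unique this
        (tendsto_const_nhds.congr fun i => (hf (φ i)).2.1.symm)
    · have : Tendsto (fun i => ∫ t, F (f (φ i) t) ∂μ) atTop (𝓝 (∫ t, F (g t) ∂μ)) := by
        refine tendsto_integral_of_dominated_convergence (fun _ => C)
          (fun i => ((hf (φ i)).1.integrable_comp hF).1) (integrable_const _) (fun i => ?_) ?_
        · filter_upwards [hall] with t ht using hC _ (ht i)
        · filter_upwards [hφ] with t ht using (hF.tendsto _).comp ht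
      exact le_of_tendsto' this fun i => (hf (φ i)).2.2
  have hbd : ∀ f ∈ K 0, ‖f‖ ≤ μ.real univ ^ ((2 : ENNReal).toReal)⁻¹ * 1 := by
    rintro f ⟨hf, -, -⟩
    exact Lp.norm_le_of_ae_bound zero_le_one hf.2
  obtain ⟨f, hf⟩ := exists_mem_iInter_of_antitone_convex hanti hne hcl hconv hbd
  refine ⟨f, (hf 0).1, (hf 0).2.1, fun v hv hvη => ?_⟩
  have h1 : ∫ t, F (f t) ∂μ ≤ sInf S := by
    refine le_of_forall_pos_le_add fun ε hε => ?_
    obtain ⟨k, hk⟩ := exists_nat_one_div_lt hε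
    exact (hf k).2.2.trans (by linarith)
  exact h1.trans (csInf_le hSbdd ⟨v, hv, hvη, rfl⟩)

/-- A minimizer of an integral functional over the unit-bounded functions minimizes the integrand
pointwise, compared with any constant. -/
theorem UnitBounded.ae_le_const_of_minimizer {μ : Measure α} [IsFiniteMeasure μ] {G : ℝ → ℝ}
    (hG : Continuous G) {q : α → ℝ} (hq : Integrable q μ) {u : α → ℝ} (hu : UnitBounded μ u)
    (hmin : ∀ v, UnitBounded μ v →
      ∫ t, (G (u t) + u t * q t) ∂μ ≤ ∫ t, (G (v t) + v t * q t) ∂μ)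
    {c : ℝ} (hc : |c| ≤ 1) : ∀ᵐ t ∂μ, G (u t) + u t * q t ≤ G c + c * q t := by
  classical
  have hint : ∀ v, UnitBounded μ v → Integrable (fun t => G (v t) + v t * q t) μ :=
    fun v hv => (hv.integrable_comp hG).add (hv.integrable_smul hq)
  have hcb : UnitBounded μ fun _ => c := UnitBounded.const hc
  refine ae_le_of_forall_setIntegral_le (hint u hu) (hint _ hcb) fun s hs _ => ?_
  -- The competitor equals `c` on `s` and `u` elsewhere, so the contributions off `s` cancel.
  have h1 := hmin _ (hcb.piecewise hu hs)
  have h2 : (fun t => G (s.piecewise (fun _ => c) u t) + s.piecewise (fun _ => c) u t * q t) =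
      s.piecewise (fun t => G c + c * q t) (fun t => G (u t) + u t * q t) := by
    ext t
    by_cases h : t ∈ s <;> simp [h]
  rw [h2, integral_piecewise hs (hint _ hcb).integrableOn (hint u hu).integrableOn,
    ← integral_add_compl hs (hint u hu)] at h1
  linarith

/-- If `q` has null level sets and `G` is convex, then `∫ G (u) + u q` has at most one minimizer
over the unit-bounded functions, up to null sets. -/
theorem UnitBounded.ae_eq_of_minimizers {μ : Measure α} [IsFiniteMeasure μ] {G : ℝ → ℝ}
    (hG : Continuous G) (hGc : ConvexOn ℝ univ G) {q : α → ℝ} (hq : Integrable q μ)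
    (hlevel : ∀ c, ∀ᵐ t ∂μ, q t ≠ c) {u v : α → ℝ} (hu : UnitBounded μ u)
    (hv : UnitBounded μ v)
    (hmin_u : ∀ w, UnitBounded μ w →
      ∫ t, (G (u t) + u t * q t) ∂μ ≤ ∫ t, (G (w t) + w t * q t) ∂μ)
    (hmin_v : ∀ w, UnitBounded μ w →
      ∫ t, (G (v t) + v t * q t) ∂μ ≤ ∫ t, (G (w t) + w t * q t) ∂μ) :
    v =ᵐ[μ] u := by
  -- Rational constants suffice, and keep the exceptional null sets countable in number.
  have hrat : ∀ w, UnitBounded μ w → (∀ w', UnitBounded μ w' →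
      ∫ t, (G (w t) + w t * q t) ∂μ ≤ ∫ t, (G (w' t) + w' t * q t) ∂μ) →
      ∀ᵐ t ∂μ, ∀ r : ℚ, |(r : ℝ)| ≤ 1 → G (w t) + w t * q t ≤ G r + r * q t := by
    intro w hw hmin
    refine ae_all_iff.2 fun r => ?_
    by_cases hr : |(r : ℝ)| ≤ 1
    · filter_upwards [hw.ae_le_const_of_minimizer hG hq hmin hr] with t ht _ using ht
    · exact ae_of_all _ fun t h => absurd h hr
  have hslope : ∀ᵐ t ∂μ, ∀ r₁ r₂ : ℚ, q t ≠ -((G r₂ - G r₁) / ((r₂ : ℝ) - r₁)) :=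
    ae_all_iff.2 fun r₁ => ae_all_iff.2 fun r₂ => hlevel _
  have key : ∀ (a b x : ℝ), (∀ r₁ r₂ : ℚ, x ≠ -((G r₂ - G r₁) / ((r₂ : ℝ) - r₁))) → |a| ≤ 1 →
      |b| ≤ 1 → (∀ r : ℚ, |(r : ℝ)| ≤ 1 → G a + a * x ≤ G r + r * x) →
      (∀ r : ℚ, |(r : ℝ)| ≤ 1 → G b + b * x ≤ G r + r * x) → ¬ a < b := by
    intro a b x hx ha hb hGa hGb hab
    obtain ⟨r₁, har, hrb⟩ := exists_rat_btwn hab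
    obtain ⟨r₂, hrr, hrb'⟩ := exists_rat_btwn hrb
    -- Convexity bounds `G r + r * x` above by the interpolation of its end values, minimality
    -- bounds it below by each of them. It is thus constant on the rationals between `a` and `b`,
    -- and the chord slope there is `-x`.
    have hflat : ∀ r : ℚ, a < r → (r : ℝ) < b → G r + r * x = G a + a * x := by
      intro r h1 h2
      have hr : |(r : ℝ)| ≤ 1 :=
        abs_le.2 ⟨(abs_le.1 ha).1.trans h1.le, h2.le.trans (abs_le.1 hb).2⟩
      have h3 := hGa r hr
      have h4 := hGb r hr
      have hba : 0 < b - a := sub_pos.2 hab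
      have hθ₁ : 0 ≤ (b - r) / (b - a) := div_nonneg (by linarith) hba.le
      have hθ₂ : 0 ≤ (r - a) / (b - a) := div_nonneg (by linarith) hba.le
      have h5 := hGc.2 (mem_univ a) (mem_univ b) hθ₁ hθ₂ (by field_simp; ring)
      have h6 : (b - r) / (b - a) * a + (r - a) / (b - a) * b = r := by field_simp; ring
      simp only [smul_eq_mul] at h5
      rw [h6] at h5
      have h7 : (b - a) * G r ≤ (b - r) * G a + (r - a) * G b := by
        calc (b - a) * G r ≤ (b - a) * _ := mul_le_mul_of_nonneg_left h5 hba.le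
          _ = _ := by field_simp
      nlinarith
    have h1 := hflat r₁ har hrb
    have h2 := hflat r₂ (har.trans hrr) hrb'
    refine hx r₁ r₂ ?_
    have : (r₂ : ℝ) - r₁ ≠ 0 := (sub_pos.2 hrr).ne'
    field_simp
    linarith
  filter_upwards [hu.2, hv.2, hrat u hu hmin_u, hrat v hv hmin_v, hslope] with t h1 h2 h3 h4 h5
  exact le_antisymm (not_lt.1 (key _ _ _ h5 h1 h2 h3 h4)) (not_lt.1 (key _ _ _ h5 h2 h1 h4 h3))

/-- Lagrange multipliers for a convex integral functional under a finite-dimensional linear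
integral constraint. -/
theorem exists_multiplier {E : Type*} [NormedAddCommGroup E] [NormedSpace ℝ E]
    [FiniteDimensional ℝ E] {μ : Measure α} [IsFiniteMeasure μ] {Φ : α → E}
    (hΦ : Integrable Φ μ) {F : ℝ → ℝ} (hF : Continuous F) (hFc : ConvexOn ℝ univ F)
    {η : E} {u : α → ℝ} (hu : UnitBounded μ u) (hη : ∫ t, u t • Φ t ∂μ = η)
    (hmin : ∀ v, UnitBounded μ v → ∫ t, v t • Φ t ∂μ = η →
      ∫ t, F (u t) ∂μ ≤ ∫ t, F (v t) ∂μ) :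
    ∃ (c : ℝ) (p : E →ₗ[ℝ] ℝ), 0 ≤ c ∧ (c ≠ 0 ∨ p ≠ 0) ∧ ∀ v, UnitBounded μ v →
      c * ∫ t, F (u t) ∂μ + p η ≤ c * ∫ t, F (v t) ∂μ + p (∫ t, v t • Φ t ∂μ) := by
  set s : Set (ℝ × E) :=
    {x | ∃ v, UnitBounded μ v ∧ ∫ t, v t • Φ t ∂μ = x.2 ∧ ∫ t, F (v t) ∂μ ≤ x.1} with hs
  have hconv : Convex ℝ s := by
    rintro x ⟨v, hv, hvx, hvF⟩ y ⟨w, hw, hwy, hwF⟩ a b ha hb hab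
    refine ⟨a • v + b • w, hv.convex_comb hw ha hb hab, ?_, ?_⟩
    · rw [UnitBounded.integral_convex_comb_smul hΦ hv hw, hvx, hwy]
      rfl
    · exact (UnitBounded.integral_convex_comb_le hF hFc hv hw ha hb hab).trans
        (add_le_add (mul_le_mul_of_nonneg_left hvF ha) (mul_le_mul_of_nonneg_left hwF hb))
  set J := ∫ t, F (u t) ∂μ with hJ
  have hxs : (J, η) ∈ s := ⟨u, hu, hη, le_rfl⟩
  have hxs' : (J + 1, η) ∈ s := ⟨u, hu, hη, by simp [hJ]⟩
  -- Otherwise the value could be lowered slightly at the same moment `η`.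
  have hxi : (J, η) ∉ interior s := by
    intro h
    have hcont : Tendsto (fun r : ℝ => (J - r, η)) (𝓝[>] 0) (𝓝 (J, η)) := by
      have : Continuous fun r : ℝ => (J - r, η) := by fun_prop
      have h0 := (this.tendsto 0).mono_left (nhdsWithin_le_nhds (s := Ioi 0))
      simpa using h0
    obtain ⟨r, ⟨v, hv, hvη, hvF⟩, hr⟩ :=
      ((hcont.eventually (mem_interior_iff_mem_nhds.1 h)).and self_mem_nhdsWithin).exists
    have h1 := hmin v hv hvη
    have h2 : (0 : ℝ) < r := hr
    simp only at hvF
    linarith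
  obtain ⟨f, hf0, hf⟩ := exists_supporting_functional hconv hxs hxi
  have hsplit : ∀ r e, f (r, e) = f (1, 0) * r + f (0, e) := by
    intro r e
    have : ((r, e) : ℝ × E) = r • (1, 0) + (0, e) := by simp
    rw [this, map_add, map_smul, smul_eq_mul, mul_comm]
  refine ⟨f (1, 0), f ∘ₗ LinearMap.inr ℝ ℝ E, ?_, ?_, fun v hv => ?_⟩
  -- `s` is closed under raising the value, which makes its multiplier nonnegative.
  · have h1 := hf _ hxs'
    rw [hsplit, hsplit (J + 1)] at h1
    linarith
  · by_contra! h
    refine hf0 (LinearMap.ext fun x => ?_)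
    have h2 : f (0, x.2) = 0 := by simpa using LinearMap.congr_fun h.2 x.2
    rw [← Prod.mk.eta (p := x), hsplit, h.1, h2]
    simp
  · have h1 := hf (∫ t, F (v t) ∂μ, ∫ t, v t • Φ t ∂μ) ⟨v, hv, rfl, le_rfl⟩
    rw [hsplit, hsplit (∫ t, F (v t) ∂μ)] at h1
    simpa using h1

end UnitBounded

/-! ### Integration by parts for absolutely continuous functions -/

section IntegrationByParts

/-- Integration by parts of a `C¹` function against an indefinite integral. -/
theorem integral_deriv_mul_add_mul {m m' g f : ℝ → ℝ} {t : ℝ} (hm : ∀ s, HasDerivAt m (m' s) s)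
    (hm' : Continuous m') (hf : IntervalIntegrable f volume 0 t)
    (hg : ∀ s ∈ uIcc 0 t, g s = g 0 + ∫ r in (0 : ℝ)..s, f r) :
    IntervalIntegrable (fun s => m' s * g s + m s * f s) volume 0 t ∧
      ∫ s in (0 : ℝ)..t, (m' s * g s + m s * f s) = m t * g t - m 0 * g 0 := by
  have hderiv : deriv m = m' := funext fun s => (hm s).deriv
  have hmC : ContDiff ℝ 1 m := contDiff_one_iff_deriv.2
    ⟨fun s => (hm s).differentiableAt, hderiv ▸ hm'⟩
  have hm_ac : AbsolutelyContinuousOnInterval m 0 t :=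
    hmC.contDiffOn.absolutelyContinuousOnInterval
  -- `g` is controlled only on the interval; `G` agrees with it there and is defined by the integral
  -- everywhere, so its derivative is `f` a.e.
  set G : ℝ → ℝ := fun s => g 0 + ∫ r in (0 : ℝ)..s, f r with hG
  have hG_ac : AbsolutelyContinuousOnInterval G 0 t :=
    (contDiffOn_const (c := g 0)).absolutelyContinuousOnInterval.add
      (hf.absolutelyContinuousOnInterval_intervalIntegral left_mem_uIcc)
  have hg_cont : ContinuousOn g (uIcc 0 t) := hG_ac.continuousOn.congr hg
  refine ⟨(hm'.continuousOn.mul hg_cont).intervalIntegrable.add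
    (hf.continuousOn_mul hmC.continuous.continuousOn), ?_⟩
  have h := hm_ac.integral_deriv_mul_eq_sub hG_ac
  have h0 : G 0 = g 0 := by simp [hG]
  rw [h0, show G t = g t from (hg t right_mem_uIcc).symm] at h
  rw [← h]
  refine intervalIntegral.integral_congr_ae ?_
  filter_upwards [hf.ae_hasDerivAt_integral] with s hs hst
  have hst' : s ∈ uIcc 0 t := uIoc_subset_uIcc hst
  have h1 : HasDerivAt G (f s) s := (hs hst' 0 left_mem_uIcc).const_add (g 0)
  rw [hderiv, h1.deriv, hg s hst']

end IntegrationByParts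

/-! ### The matrix exponential and the product rule -/

section MatrixExponential

variable {n : ℕ}

-- Composing with a scalar functional keeps the choice of matrix norm out of the conclusion.
open scoped Matrix.Norms.Operator in
theorem hasDerivAt_linearMap_exp (A : Matrix (Fin n) (Fin n) ℝ)
    (L : Matrix (Fin n) (Fin n) ℝ →ₗ[ℝ] ℝ) (t : ℝ) :
    HasDerivAt (fun t : ℝ => L (NormedSpace.exp (t • A)))
      (L (NormedSpace.exp (t • A) * A)) t :=
  (LinearMap.toContinuousLinearMap L).hasFDerivAt.comp_hasDerivAt t
    (hasDerivAt_exp_smul_const A t)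

open scoped Matrix.Norms.Operator in
theorem analyticAt_linearMap_exp (A : Matrix (Fin n) (Fin n) ℝ)
    (L : Matrix (Fin n) (Fin n) ℝ →ₗ[ℝ] ℝ) (t : ℝ) :
    AnalyticAt ℝ (fun t : ℝ => L (NormedSpace.exp (t • A))) t := by
  have h1 : AnalyticAt ℝ (fun t : ℝ => t • A) t := analyticAt_id.smul analyticAt_const
  exact ((LinearMap.toContinuousLinearMap L).analyticAt _).comp
    (AnalyticAt.comp (f := fun t : ℝ => t • A) (NormedSpace.exp_analytic (𝕂 := ℝ) (t • A)) h1)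

theorem commute_exp_smul (A : Matrix (Fin n) (Fin n) ℝ) (t : ℝ) :
    Commute (NormedSpace.exp (t • A)) A := by
  open scoped Matrix.Norms.Operator in
  exact ((Commute.refl A).smul_left t).exp_left

theorem exp_smul_mul_exp_neg_smul (A : Matrix (Fin n) (Fin n) ℝ) (t : ℝ) :
    NormedSpace.exp (t • A) * NormedSpace.exp (-(t • A)) = 1 := by
  rw [← Matrix.exp_add_of_commute _ _ (Commute.refl (t • A)).neg_right, add_neg_cancel,
    NormedSpace.exp_zero]

theorem continuous_exp_smul (A : Matrix (Fin n) (Fin n) ℝ) :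
    Continuous fun t : ℝ => NormedSpace.exp (t • A) :=
  continuous_matrix fun i j => continuous_iff_continuousAt.2 fun t =>
    (hasDerivAt_linearMap_exp A (Matrix.entryLinearMap ℝ ℝ i j) t).continuousAt

theorem continuous_exp_neg_smul (A : Matrix (Fin n) (Fin n) ℝ) :
    Continuous fun t : ℝ => NormedSpace.exp (-(t • A)) := by
  simpa only [smul_neg] using continuous_exp_smul (-A)

theorem intervalIntegrable_eval {f : ℝ → Fin n → ℝ} {a b : ℝ}
    (hf : IntervalIntegrable f volume a b) (i : Fin n) :
    IntervalIntegrable (fun s => f s i) volume a b :=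
  ⟨(ContinuousLinearMap.proj (R := ℝ) (φ := fun _ : Fin n => ℝ) i).integrable_comp hf.1,
    (ContinuousLinearMap.proj (R := ℝ) (φ := fun _ : Fin n => ℝ) i).integrable_comp hf.2⟩

theorem intervalIntegral_eval {f : ℝ → Fin n → ℝ} {a b : ℝ}
    (hf : IntervalIntegrable f volume a b) (i : Fin n) :
    (∫ s in a..b, f s) i = ∫ s in a..b, f s i :=
  ((ContinuousLinearMap.proj (R := ℝ) (φ := fun _ : Fin n => ℝ) i).intervalIntegral_comp_comm
    hf).symm

/-- The product rule for `t ↦ exp (t A) x t` in integrated form, for an indefinite integral `x`. -/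
theorem exp_mulVec_eq_add_integral (A : Matrix (Fin n) (Fin n) ℝ) {x f : ℝ → Fin n → ℝ} {t : ℝ}
    (hf : IntervalIntegrable f volume 0 t)
    (hx : ∀ s ∈ uIcc 0 t, x s = x 0 + ∫ r in (0 : ℝ)..s, f r) :
    NormedSpace.exp (t • A) *ᵥ x t =
      x 0 + ∫ s in (0 : ℝ)..t, NormedSpace.exp (s • A) *ᵥ (A *ᵥ x s + f s) := by
  set M : ℝ → Matrix (Fin n) (Fin n) ℝ := fun s => NormedSpace.exp (s • A) with hM
  have hMc : Continuous M := continuous_exp_smul A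
  have hparts : ∀ i j, IntervalIntegrable
      (fun s => (M s * A) i j * x s j + M s i j * f s j) volume 0 t ∧
      ∫ s in (0 : ℝ)..t, ((M s * A) i j * x s j + M s i j * f s j) =
        M t i j * x t j - M 0 i j * x 0 j := by
    intro i j
    refine integral_deriv_mul_add_mul (g := fun s => x s j)
      (fun s => hasDerivAt_linearMap_exp A (Matrix.entryLinearMap ℝ ℝ i j) s)
      ((hMc.matrix_mul continuous_const).matrix_elem i j) (intervalIntegrable_eval hf j) ?_
    intro s hs
    have hfs : IntervalIntegrable f volume 0 s :=
      hf.mono_set (uIcc_subset_uIcc left_mem_uIcc hs)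
    rw [hx s hs, Pi.add_apply, intervalIntegral_eval hfs]
  have hsum : ∀ i, (fun s => (M s *ᵥ (A *ᵥ x s + f s)) i) =
      fun s => ∑ j, ((M s * A) i j * x s j + M s i j * f s j) := by
    intro i
    ext s
    rw [Matrix.mulVec_add, Matrix.mulVec_mulVec, Finset.sum_add_distrib]
    rfl
  have hint : IntervalIntegrable (fun s => M s *ᵥ (A *ᵥ x s + f s)) volume 0 t := by
    have hi : ∀ i, IntervalIntegrable (fun s => (M s *ᵥ (A *ᵥ x s + f s)) i) volume 0 t := by
      intro i
      rw [hsum i]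
      simpa only [Finset.sum_fn] using
        IntervalIntegrable.sum Finset.univ fun j _ => (hparts i j).1
    exact ⟨Integrable.of_eval fun i => (hi i).1, Integrable.of_eval fun i => (hi i).2⟩
  ext i
  rw [Pi.add_apply, intervalIntegral_eval hint, hsum i,
    intervalIntegral.integral_finsetSum fun j _ => (hparts i j).1,
    Finset.sum_congr rfl fun j _ => (hparts i j).2, Finset.sum_sub_distrib]
  have h0 : ∑ j, M 0 i j * x 0 j = x 0 i := by
    have : M 0 *ᵥ x 0 = x 0 := by simp [hM]
    exact congrFun this i
  rw [h0, add_sub_cancel]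
  rfl

end MatrixExponential

/-! ### Null level sets from controllability -/

section Controllability

variable {n : ℕ} {A : Matrix (Fin n) (Fin n) ℝ} {B : Fin n → ℝ}

/-- Nonsingularity absorbs the shift in the exponent: each `x` is `A y`, and `y` is a combination of
the `A ^ k B`. -/
theorem Controllable.eq_zero_of_forall_pow (hA : IsUnit A) (hAB : Controllable A B)
    {p : (Fin n → ℝ) →ₗ[ℝ] ℝ} (hp : ∀ k : ℕ, p ((A ^ (k + 1)) *ᵥ B) = 0) : p = 0 := by
  have hrange : LinearMap.range (controllabilityMatrix A B).mulVecLin = ⊤ := by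
    refine Submodule.eq_top_of_finrank_eq ?_
    rw [Module.finrank_fin_fun]
    exact hAB
  refine LinearMap.ext fun x => ?_
  obtain ⟨y, hy⟩ := (Matrix.mulVec_surjective_iff_isUnit.2 hA) x
  obtain ⟨z, hz⟩ := LinearMap.range_eq_top.1 hrange y
  have hz' : y = ∑ k, z k • ((A ^ (k : ℕ)) *ᵥ B) := by
    rw [← hz, Matrix.mulVecLin_apply, Matrix.mulVec_eq_sum]
    simp only [controllabilityMatrix]
    refine Finset.sum_congr rfl fun k _ => ?_
    ext i
    simp [mul_comm]
  rw [← hy, hz', Matrix.mulVec_sum, map_sum, LinearMap.zero_apply]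
  refine Finset.sum_eq_zero fun k _ => ?_
  rw [Matrix.mulVec_smul, Matrix.mulVec_mulVec, ← pow_succ', map_smul, hp, smul_zero]

/-- For a controllable pair with nonsingular `A`, the functions `t ↦ p (exp (-t A) B)` with
`p ≠ 0` have null level sets. -/
theorem Controllable.ae_ne (hA : IsUnit A) (hAB : Controllable A B)
    {p : (Fin n → ℝ) →ₗ[ℝ] ℝ} (hp : p ≠ 0) (c : ℝ) :
    ∀ᵐ t : ℝ, p (NormedSpace.exp (-(t • A)) *ᵥ B) ≠ c := by
  have hmv : ∀ C D : Matrix (Fin n) (Fin n) ℝ, (C + D) *ᵥ B = C *ᵥ B + D *ᵥ B :=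
    fun C D => Matrix.add_mulVec C D B
  -- Chosen so that `q k` is the `k`-th derivative of `q 0`.
  let L : ℕ → Matrix (Fin n) (Fin n) ℝ →ₗ[ℝ] ℝ := fun k =>
    { toFun := fun C => p ((C * (-A) ^ k) *ᵥ B)
      map_add' := fun C D => by rw [add_mul, hmv, map_add]
      map_smul' := fun r C => by simp [Matrix.smul_mulVec, map_smul] }
  let q : ℕ → ℝ → ℝ := fun k t => L k (NormedSpace.exp (t • -A))
  have hq0 : ∀ t, q 0 t = p (NormedSpace.exp (-(t • A)) *ᵥ B) := fun t => by
    simp [q, L, smul_neg]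
  have hderiv : ∀ k t, HasDerivAt (q k) (q (k + 1) t) t := by
    intro k t
    have h := hasDerivAt_linearMap_exp (-A) (L k) t
    have h2 : L k (NormedSpace.exp (t • -A) * -A) = q (k + 1) t := by
      simp only [q, L, LinearMap.coe_mk, AddHom.coe_mk, mul_assoc, pow_succ']
    rwa [h2] at h
  -- Were `q 0` constant, its derivatives of order at least one would vanish at `0`, giving `p (A ^
  -- (k + 1) B) = 0` for all `k`.
  have hne : ∃ t, q 0 t - c ≠ 0 := by
    by_contra! hc
    have hconst : ∀ k, ∃ d, ∀ t, q k t = d := by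
      intro k
      induction k with
      | zero => exact ⟨c, fun t => sub_eq_zero.1 (hc t)⟩
      | succ k ih =>
        obtain ⟨d, hd⟩ := ih
        refine ⟨0, fun t => (hderiv k t).unique ?_⟩
        rw [show q k = fun _ => d from funext hd]
        exact hasDerivAt_const t d
    refine hp (hAB.eq_zero_of_forall_pow hA fun k => ?_)
    obtain ⟨d, hd⟩ := hconst k
    have h1 : q (k + 1) 0 = 0 := by
      refine (hderiv k 0).unique ?_
      rw [show q k = fun _ => d from funext hd]
      exact hasDerivAt_const 0 d
    have h2 : q (k + 1) 0 = p (((-A) ^ (k + 1)) *ᵥ B) := by simp [q, L]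
    rw [h2] at h1
    rw [neg_pow] at h1
    rcases neg_one_pow_eq_or (Matrix (Fin n) (Fin n) ℝ) (k + 1) with h | h
    · rwa [h, one_mul] at h1
    · rwa [h, neg_one_mul, Matrix.neg_mulVec, map_neg, neg_eq_zero] at h1
  obtain ⟨t₀, ht₀⟩ := hne
  have han : AnalyticOnNhd ℝ (fun t => q 0 t - c) univ := fun t _ =>
    (analyticAt_linearMap_exp (-A) (L 0) t).sub analyticAt_const
  -- The zeros of an analytic function that is not identically zero form a discrete, hence null,
  -- set.
  have h := ae_restrict_le_codiscreteWithin (μ := (volume : Measure ℝ)) MeasurableSet.univ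
    (han.preimage_zero_mem_codiscrete ht₀)
  rw [Measure.restrict_univ] at h
  filter_upwards [h] with t ht h'
  refine ht ?_
  rw [mem_singleton_iff, ← h', ← hq0]
  exact sub_self _

end Controllability

theorem boundedControl_one_iff {T : ℝ} {u : ℝ → ℝ} :
    BoundedControl T 1 u ↔ UnitBounded (volume.restrict (Icc 0 T)) u := by
  refine and_congr_right fun _ => ?_
  rw [eLpNorm_exponent_top]
  constructor
  · intro h
    filter_upwards [ae_le_eLpNormEssSup (f := u) (μ := volume.restrict (Icc 0 T))] with t ht
    have := ht.trans h
    rw [← ofReal_norm, ENNReal.ofReal_le_ofReal_iff zero_le_one] at this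
    exact this
  · exact fun h => eLpNormEssSup_le_of_ae_bound h

theorem intervalIntegral_eq_setIntegral_Icc {E : Type*} [NormedAddCommGroup E] [NormedSpace ℝ E]
    {T : ℝ} (hT : 0 ≤ T) (f : ℝ → E) : ∫ t in (0 : ℝ)..T, f t = ∫ t in Icc 0 T, f t := by
  rw [intervalIntegral.integral_of_le hT, integral_Icc_eq_integral_Ioc]

theorem intervalIntegrable_of_integrable_Icc {E : Type*} [NormedAddCommGroup E]
    {T : ℝ} (hT : 0 ≤ T) {f : ℝ → E} (hf : Integrable f (volume.restrict (Icc 0 T))) :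
    IntervalIntegrable f volume 0 T :=
  (intervalIntegrable_iff_integrableOn_Icc_of_le hT).2 hf

/-! ### Feasibility as a moment condition -/

section Feasible

variable {n : ℕ} (A : Matrix (Fin n) (Fin n) ℝ) (B : Fin n → ℝ) {T : ℝ}

theorem continuous_exp_neg_smul_mulVec :
    Continuous fun t : ℝ => NormedSpace.exp (-(t • A)) *ᵥ B :=
  (continuous_exp_neg_smul A).matrix_mulVec continuous_const

theorem integrable_exp_neg_smul_mulVec :
    Integrable (fun t : ℝ => NormedSpace.exp (-(t • A)) *ᵥ B) (volume.restrict (Icc 0 T)) :=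
  (continuous_exp_neg_smul_mulVec A B).continuousOn.integrableOn_Icc

/-- Variation of constants: a bounded control steers `ξ` to the origin if and only if its weighted
moment equals `-ξ`. -/
theorem mem_feasible_iff (hT : 0 ≤ T) {ξ : Fin n → ℝ} {u : ℝ → ℝ} :
    u ∈ feasible A B T ξ ↔ UnitBounded (volume.restrict (Icc 0 T)) u ∧
      ∫ t in Icc 0 T, u t • (NormedSpace.exp (-(t • A)) *ᵥ B) = -ξ := by
  rw [← intervalIntegral_eq_setIntegral_Icc hT, feasible, mem_ofPred_eq, boundedControl_one_iff]
  refine and_congr_right fun hu => ?_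
  have hu_int : IntervalIntegrable u volume 0 T :=
    intervalIntegrable_of_integrable_Icc hT hu.integrable
  have huΦ : IntervalIntegrable (fun t => u t • (NormedSpace.exp (-(t • A)) *ᵥ B)) volume 0 T :=
    intervalIntegrable_of_integrable_Icc hT
      (hu.integrable_smul (integrable_exp_neg_smul_mulVec A B))
  constructor
  · rintro ⟨x, ⟨-, hxc, hx⟩, rfl, hxT⟩
    have hxc' : ContinuousOn (fun s => A *ᵥ x s) (uIcc 0 T) := by
      rw [uIcc_of_le hT]
      exact (Continuous.matrix_mulVec continuous_const continuous_id).comp_continuousOn hxc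
    have huB : IntervalIntegrable (fun s => u s • B) volume 0 T :=
      ⟨hu_int.1.smul_const B, hu_int.2.smul_const B⟩
    -- With the whole right-hand side as forcing term, the `A x` contributions cancel.
    have h := exp_mulVec_eq_add_integral (-A) (hxc'.intervalIntegrable.add huB)
      (by rw [uIcc_of_le hT]; exact hx)
    rw [hxT, Matrix.mulVec_zero] at h
    have h2 : ∀ s : ℝ, NormedSpace.exp (s • -A) *ᵥ
        (-A *ᵥ x s + (A *ᵥ x s + u s • B)) = u s • (NormedSpace.exp (-(s • A)) *ᵥ B) := by
      intro s
      rw [Matrix.neg_mulVec, neg_add_cancel_left, Matrix.mulVec_smul, smul_neg]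
    rw [intervalIntegral.integral_congr fun s _ => h2 s] at h
    exact eq_neg_of_add_eq_zero_right h.symm
  · intro hξ
    -- `y t` plays the role of `e^{-tA} x(t)`; the trajectory is recovered as `e^{tA} y t`.
    set y : ℝ → Fin n → ℝ := fun t =>
      ξ + ∫ s in (0 : ℝ)..t, u s • (NormedSpace.exp (-(s • A)) *ᵥ B) with hy
    have hy0 : y 0 = ξ := by simp [hy]
    have hyc : ContinuousOn y (Icc 0 T) := by
      have := intervalIntegral.continuousOn_primitive_interval' huΦ left_mem_uIcc
      rw [uIcc_of_le hT] at this
      exact continuousOn_const.add this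
    have hx0 : NormedSpace.exp ((0 : ℝ) • A) *ᵥ y 0 = ξ := by simp [hy0]
    refine ⟨fun t => NormedSpace.exp (t • A) *ᵥ y t, ⟨hu_int, ?_, fun t ht => ?_⟩, hx0, ?_⟩
    · exact (Continuous.matrix_mulVec continuous_fst continuous_snd).comp_continuousOn
        ((continuous_exp_smul A).continuousOn.prodMk hyc)
    · have hsub : uIcc 0 t ⊆ uIcc 0 T := by
        rw [uIcc_of_le ht.1, uIcc_of_le hT]
        exact Icc_subset_Icc_right ht.2
      have h := exp_mulVec_eq_add_integral A (x := y) (huΦ.mono_set hsub)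
        (fun s _ => by rw [hy0])
      beta_reduce
      rw [h, hx0, hy0]
      congr 1
      refine intervalIntegral.integral_congr fun s _ => ?_
      rw [Matrix.mulVec_add, Matrix.mulVec_smul, Matrix.mulVec_mulVec, Matrix.mulVec_mulVec,
        Matrix.mulVec_mulVec, exp_smul_mul_exp_neg_smul, Matrix.one_mulVec,
        (commute_exp_smul A s).eq]
    · have hyT : y T = 0 := by rw [hy]; beta_reduce; rw [hξ, add_neg_cancel]
      beta_reduce
      rw [hyT, Matrix.mulVec_zero]

/-- Steering `ξ` to the origin needs moment `-ξ`, so the control representing `ξ` is negated. -/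
theorem feasible_nonempty (hT : 0 ≤ T) {ξ : Fin n → ℝ} (hξ : ξ ∈ reachable A B T) :
    (feasible A B T ξ).Nonempty := by
  obtain ⟨u, hu, rfl⟩ := hξ
  rw [boundedControl_one_iff] at hu
  refine ⟨fun t => -u t, (mem_feasible_iff A B hT).2 ⟨⟨hu.1.neg, ?_⟩, ?_⟩⟩
  · filter_upwards [hu.2] with t ht
    rwa [abs_neg]
  · simp only [neg_smul]
    rw [integral_neg, intervalIntegral_eq_setIntegral_Icc hT]

end Feasible

/-! ### The cost density and its minimum -/

section Cost

variable {N : ℕ} (U w : Fin (N + 1) → ℝ)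

/-- The integrand `∑ i, w i (|s - U i| + |s + U i|)` of the SOAV cost. -/
def costDensity (s : ℝ) : ℝ := ∑ i, w i * (|s - U i| + |s + U i|)

theorem continuous_costDensity : Continuous (costDensity U w) := by
  unfold costDensity
  fun_prop

theorem convexOn_costDensity {w : Fin (N + 1) → ℝ} (hw : ∀ i, 0 ≤ w i) :
    ConvexOn ℝ univ (costDensity U w) := by
  have habs : ∀ c : ℝ, ConvexOn ℝ univ fun s : ℝ => |s + c| := by
    intro c
    refine ⟨convex_univ, fun x _ y _ a b ha hb hab => ?_⟩
    have h : a • x + b • y + c = a • (x + c) + b • (y + c) := by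
      simp only [smul_eq_mul]
      linear_combination -c * hab
    beta_reduce
    rw [h]
    refine (abs_add_le _ _).trans_eq ?_
    simp only [smul_eq_mul, abs_mul, abs_of_nonneg ha, abs_of_nonneg hb]
  have hsum : ∀ I : Finset (Fin (N + 1)),
      ConvexOn ℝ univ fun s => ∑ i ∈ I, w i * (|s - U i| + |s + U i|) := by
    intro I
    induction I using Finset.cons_induction with
    | empty => simpa using convexOn_const (0 : ℝ) convex_univ
    | cons i I hi ih =>
      simp only [Finset.sum_cons, sub_eq_add_neg] at ih ⊢
      exact (((habs (-U i)).add (habs (U i))).smul (hw i)).add ih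
  exact hsum Finset.univ

variable {U w} {T : ℝ}

theorem cost_eq_integral (hT : 0 ≤ T) {u : ℝ → ℝ}
    (hu : UnitBounded (volume.restrict (Icc 0 T)) u) :
    cost T U w u = ∫ t in Icc 0 T, costDensity U w (u t) := by
  have h1 : ∀ c : ℝ, Integrable (fun t => |u t - c|) (volume.restrict (Icc 0 T)) := fun c =>
    hu.integrable_comp (F := fun s => |s - c|) (by fun_prop)
  have h2 : ∀ c : ℝ, Integrable (fun t => |u t + c|) (volume.restrict (Icc 0 T)) := fun c =>
    hu.integrable_comp (F := fun s => |s + c|) (by fun_prop)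
  unfold cost costDensity l1Norm
  refine Eq.trans ?_ (integral_finsetSum _
    fun i _ => ((h1 (U i)).add (h2 (U i))).const_mul (w i)).symm
  refine Finset.sum_congr rfl fun i _ => ?_
  simp only [Pi.add_apply]
  rw [integral_const_mul, integral_add (h1 _) (h2 _), intervalIntegral_eq_setIntegral_Icc hT,
    intervalIntegral_eq_setIntegral_Icc hT]

theorem two_mul_le_abs_sub_add_abs_add (s c : ℝ) : 2 * c ≤ |s - c| + |s + c| := by
  linarith [neg_abs_le (s - c), le_abs_self (s + c)]

theorem le_costDensity (hw : ∀ i, 0 ≤ w i) (s : ℝ) : 2 * ∑ i, w i * U i ≤ costDensity U w s := by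
  rw [Finset.mul_sum]
  refine Finset.sum_le_sum fun i _ => ?_
  nlinarith [mul_le_mul_of_nonneg_left (two_mul_le_abs_sub_add_abs_add s (U i)) (hw i)]

theorem costDensity_zero (hU : ∀ i, 0 ≤ U i) : costDensity U w 0 = 2 * ∑ i, w i * U i := by
  rw [costDensity, Finset.mul_sum]
  refine Finset.sum_congr rfl fun i _ => ?_
  rw [zero_sub, zero_add, abs_neg, abs_of_nonneg (hU i)]
  ring

/-- If the smallest level is zero, the cost density attains its minimum only at zero. -/
theorem eq_zero_of_costDensity_le (hw : ∀ i, 0 ≤ w i) (hw0 : 0 < w 0) (hU0 : U 0 = 0) {s : ℝ}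
    (hs : costDensity U w s ≤ 2 * ∑ i, w i * U i) : s = 0 := by
  rw [costDensity, Finset.mul_sum, Fin.sum_univ_succ, Fin.sum_univ_succ] at hs
  -- The terms of positive index already reach their share of the lower bound, leaving no room for
  -- `w 0 * |s|`.
  have h : ∑ i : Fin N, 2 * (w i.succ * U i.succ) ≤
      ∑ i : Fin N, w i.succ * (|s - U i.succ| + |s + U i.succ|) := by
    refine Finset.sum_le_sum fun i _ => ?_
    nlinarith [mul_le_mul_of_nonneg_left (two_mul_le_abs_sub_add_abs_add s (U i.succ))
      (hw i.succ)]
  rw [hU0, sub_zero, add_zero] at hs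
  have h2 : w 0 * |s| ≤ 0 := by linarith
  exact abs_nonpos_iff.1 (nonpos_of_mul_nonpos_right h2 hw0)

theorem costMin_eq_integral (hT : 0 ≤ T) :
    costMin T U w = ∫ _ in Icc 0 T, 2 * ∑ i, w i * U i := by
  rw [setIntegral_const, Real.volume_real_Icc_of_le hT, costMin, smul_eq_mul]
  ring

theorem costMin_le_cost (hT : 0 ≤ T) (hw : ∀ i, 0 ≤ w i) {u : ℝ → ℝ}
    (hu : UnitBounded (volume.restrict (Icc 0 T)) u) : costMin T U w ≤ cost T U w u := by
  rw [cost_eq_integral hT hu, costMin_eq_integral hT]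
  exact integral_mono (integrable_const _) (hu.integrable_comp (continuous_costDensity U w))
    fun t => le_costDensity hw (u t)

end Cost

/-! ### Existence and uniqueness of optimal controls -/

section Optimal

variable {n N : ℕ} {A : Matrix (Fin n) (Fin n) ℝ} {B : Fin n → ℝ} {T : ℝ}
  {U w : Fin (N + 1) → ℝ} {ξ : Fin n → ℝ}

theorem exists_isOptimal (hT : 0 ≤ T) (hw : ∀ i, 0 ≤ w i) (hξ : ξ ∈ reachable A B T) :
    ∃ u, IsOptimal A B T U w ξ u := by
  obtain ⟨u₀, hu₀⟩ := feasible_nonempty A B hT hξ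
  rw [mem_feasible_iff A B hT] at hu₀
  obtain ⟨u, hu, huξ, hmin⟩ := exists_unitBounded_minimizer
    (integrable_exp_neg_smul_mulVec A B) (continuous_costDensity U w)
    (convexOn_costDensity U hw) hu₀.1 hu₀.2
  refine ⟨u, (mem_feasible_iff A B hT).2 ⟨hu, huξ⟩, fun v hv => ?_⟩
  rw [mem_feasible_iff A B hT] at hv
  rw [cost_eq_integral hT hu, cost_eq_integral hT hv.1]
  exact hmin v hv.1 hv.2

theorem IsOptimal.cost_eq {u v : ℝ → ℝ} (hu : IsOptimal A B T U w ξ u)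
    (hv : IsOptimal A B T U w ξ v) : cost T U w u = cost T U w v :=
  le_antisymm (hu.2 v hv.1) (hv.2 u hu.1)

/-- Optimal controls agree almost everywhere as soon as the optimal value is not `J_min`. -/
theorem IsOptimal.ae_eq (hT : 0 ≤ T) (hU : ∀ i, 0 ≤ U i) (hw : ∀ i, 0 ≤ w i) (hA : IsUnit A)
    (hAB : Controllable A B) (hξ : ξ ∉ reachableMin A B T U w) {u v : ℝ → ℝ}
    (hu : IsOptimal A B T U w ξ u) (hv : IsOptimal A B T U w ξ v) :
    v =ᵐ[volume.restrict (Icc 0 T)] u := by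
  have hF := continuous_costDensity U w
  have hFc := convexOn_costDensity U hw
  have hΦ := integrable_exp_neg_smul_mulVec A B (T := T)
  obtain ⟨hu1, hu2⟩ := (mem_feasible_iff A B hT).1 hu.1
  obtain ⟨hv1, hv2⟩ := (mem_feasible_iff A B hT).1 hv.1
  have huv := hu.cost_eq hv
  rw [cost_eq_integral hT hu1, cost_eq_integral hT hv1] at huv
  have hmin : ∀ z, UnitBounded (volume.restrict (Icc 0 T)) z →
      ∫ t in Icc 0 T, z t • (NormedSpace.exp (-(t • A)) *ᵥ B) = -ξ →
      ∫ t in Icc 0 T, costDensity U w (u t) ≤ ∫ t in Icc 0 T, costDensity U w (z t) := by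
    intro z hz hzξ
    rw [← cost_eq_integral hT hu1, ← cost_eq_integral hT hz]
    exact hu.2 z ((mem_feasible_iff A B hT).2 ⟨hz, hzξ⟩)
  obtain ⟨c, p, hc, hcp, hmult⟩ := exists_multiplier hΦ hF hFc hu1 hu2 hmin
  -- If `p = 0`, then `c > 0` and `u` minimizes the cost without the moment constraint; the zero
  -- control then brings its cost down to `J_min`.
  by_cases hp : p = 0
  · exfalso
    have hc' : 0 < c := lt_of_le_of_ne hc (by rintro rfl; simp [hp] at hcp)
    have h0 : UnitBounded (volume.restrict (Icc 0 T)) fun _ => (0 : ℝ) :=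
      UnitBounded.const (by simp)
    have h1 := hmult _ h0
    simp only [hp, LinearMap.zero_apply, add_zero] at h1
    have h2 := le_of_mul_le_mul_left h1 hc'
    rw [costDensity_zero hU, ← costMin_eq_integral hT, ← cost_eq_integral hT hu1] at h2
    refine hξ ⟨⟨u, hu.1, le_antisymm h2 (costMin_le_cost hT hw hu1)⟩, ?_⟩
    rintro _ ⟨z, hz, rfl⟩
    exact costMin_le_cost hT hw ((mem_feasible_iff A B hT).1 hz).1
  · set q : ℝ → ℝ := fun t => p (NormedSpace.exp (-(t • A)) *ᵥ B) with hq
    have hpc : Continuous p := p.continuous_of_finiteDimensional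
    have hq_int : Integrable q (volume.restrict (Icc 0 T)) :=
      (hpc.comp (continuous_exp_neg_smul_mulVec A B)).continuousOn.integrableOn_Icc
    have hlag : ∀ z, UnitBounded (volume.restrict (Icc 0 T)) z →
        ∫ t in Icc 0 T, (c * costDensity U w (z t) + z t * q t) =
          c * (∫ t in Icc 0 T, costDensity U w (z t)) +
            p (∫ t in Icc 0 T, z t • (NormedSpace.exp (-(t • A)) *ᵥ B)) := by
      intro z hz
      have h1 := (LinearMap.toContinuousLinearMap p).integral_comp_comm (hz.integrable_smul hΦ)
      simp only [LinearMap.coe_toContinuousLinearMap', map_smul, smul_eq_mul] at h1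
      have hzq : Integrable (fun t => z t * q t) (volume.restrict (Icc 0 T)) :=
        hz.integrable_smul hq_int
      rw [integral_add ((hz.integrable_comp hF).const_mul c) hzq, integral_const_mul, ← h1]
    -- The case `c = 0` is included: `G` need only be convex.
    refine UnitBounded.ae_eq_of_minimizers (G := fun s => c * costDensity U w s)
      (hF.const_mul c) (hFc.smul hc) hq_int
      (fun d => ae_restrict_of_ae (hAB.ae_ne hA hp d)) hu1 hv1 ?_ ?_
    · intro z hz
      rw [hlag u hu1, hlag z hz, hu2]
      exact hmult z hz
    -- `v` has the same cost and moment as `u`, so the multipliers found for `u` serve it too.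
    · intro z hz
      rw [hlag v hv1, hlag z hz, hv2, ← huv]
      exact hmult z hz

/-- If the smallest level is zero, a control of cost `J_min` vanishes almost everywhere. -/
theorem ae_eq_zero_of_cost_eq_costMin (hT : 0 ≤ T) (hw : ∀ i, 0 ≤ w i) (hw0 : 0 < w 0)
    (hU0 : U 0 = 0) {u : ℝ → ℝ} (hu : UnitBounded (volume.restrict (Icc 0 T)) u)
    (hcost : cost T U w u = costMin T U w) : u =ᵐ[volume.restrict (Icc 0 T)] 0 := by
  rw [cost_eq_integral hT hu, costMin_eq_integral hT] at hcost
  have h := (integral_eq_iff_of_ae_le (integrable_const _)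
    (hu.integrable_comp (continuous_costDensity U w))
    (ae_of_all _ fun t => le_costDensity hw (u t))).1 hcost.symm
  filter_upwards [h] with t ht
  exact eq_zero_of_costDensity_le hw hw0 hU0 ht.ge

end Optimal

end SOAV

/-! ### The main theorem -/

theorem theorem4 (n N : ℕ) (A : Matrix (Fin n) (Fin n) ℝ) (B : Fin n → ℝ)
    (T : ℝ) (hT : 0 < T)
    (U w : Fin (N + 1) → ℝ)
    (hU_nonneg : 0 ≤ U 0) (hU_mono : StrictMono U) (hU_last : U (Fin.last N) = 1)
    (hw_nonneg : ∀ i, 0 ≤ w i) (hw_first : 0 < w 0) (hw_sum : ∑ i, w i = 1)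
    (hA : IsUnit A) (hAB : SOAV.Controllable A B) :
    (∀ ξ ∈ SOAV.reachable A B T \ SOAV.reachableMin A B T U w,
      SOAV.HasUniqueOptimal A B T U w ξ) ∧
    (U 0 = 0 → ∀ ξ ∈ SOAV.reachable A B T, SOAV.HasUniqueOptimal A B T U w ξ) := by
  have hU : ∀ i, 0 ≤ U i := fun i => hU_nonneg.trans (hU_mono.monotone (Fin.zero_le i))
  have hmain : ∀ ξ ∈ SOAV.reachable A B T \ SOAV.reachableMin A B T U w,
      SOAV.HasUniqueOptimal A B T U w ξ := by
    rintro ξ ⟨hξ, hξmin⟩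
    obtain ⟨u, hu⟩ := SOAV.exists_isOptimal (U := U) hT.le hw_nonneg hξ
    exact ⟨u, hu, fun v hv => hu.ae_eq hT.le hU hw_nonneg hA hAB hξmin hv⟩
  refine ⟨hmain, fun hU0 ξ hξ => ?_⟩
  by_cases hξmin : ξ ∈ SOAV.reachableMin A B T U w
  · obtain ⟨⟨u, hu, hucost⟩, hlb⟩ := hξmin
    have huopt : SOAV.IsOptimal A B T U w ξ u :=
      ⟨hu, fun v hv => hucost.trans_le (hlb ⟨v, hv, rfl⟩)⟩
    have hzero : ∀ v, SOAV.IsOptimal A B T U w ξ v →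
        v =ᵐ[volume.restrict (Icc 0 T)] 0 := fun v hv =>
      SOAV.ae_eq_zero_of_cost_eq_costMin hT.le hw_nonneg hw_first hU0
        ((SOAV.mem_feasible_iff A B hT.le).1 hv.1).1 ((hv.cost_eq huopt).trans hucost)
    exact ⟨u, huopt, fun v hv => (hzero v hv).trans (hzero u huopt).symm⟩
  · exact hmain ξ ⟨hξ, hξmin⟩
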